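/- Let $G$ be a finite simple graph. Two edges $ab, cd \in E(G)$ form an alternating 4-cycle in $G$ if, for some labelling of the endpoints of each edge, $ad$ and $bc$ are edges of the complement $\overline{G}$. The auxiliary graph $G^*$ has vertex set $E(G)$, and two edges of $G$ are adjacent in $G^*$ if and only if they form an alternating 4-cycle in $G$. A graph is a threshold graph if no two of its edges form an alternating 4-cycle in it, and the threshold dimension $\operatorname{th}(G)$ is the least integer $k$ such that $E(G) = E(H_1)\cup\dots\cup E(H_k)$ for some threshold graphs $H_1,\dots,H_k$. Then $$\chi(G^*) = 2 \iff \operatorname{th}(G) = 2 .$$ -/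

import Mathlib

namespace ThresholdCover

variable {V : Type*}

/-- Two edges `ab` and `cd` of `G` (unordered pairs, given in some labelling of their endpoints)
form an alternating 4-cycle if `ad` and `bc` are edges of the complement of `G`. -/
def FormAlternating4Cycle (G : SimpleGraph V) (e f : Sym2 V) : Prop :=
  ∃ a b c d : V, e = s(a, b) ∧ f = s(c, d) ∧
    G.Adj a b ∧ G.Adj c d ∧ Gᶜ.Adj a d ∧ Gᶜ.Adj b c

/-- A threshold graph: no pair of edges forms an alternating 4-cycle. -/
def IsThreshold (G : SimpleGraph V) : Prop :=
  ∀ e f : Sym2 V, ¬ FormAlternating4Cycle G e f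

/-- `G` has a threshold cover of size `k`: its edge set is the union of the edge sets of `k`
threshold graphs. These may be taken on the vertex set of `G`, since adding isolated vertices to
a graph neither creates nor destroys alternating 4-cycles. -/
def HasThresholdCover (G : SimpleGraph V) (k : ℕ) : Prop :=
  ∃ H : Fin k → SimpleGraph V,
    (∀ i, IsThreshold (H i)) ∧ G.edgeSet = ⋃ i, (H i).edgeSet

/-- The threshold dimension: the least `k` such that `G` has a threshold cover of size `k`
(and `⊤` if there is none, which happens for no finite graph). -/
noncomputable def thresholdDimension (G : SimpleGraph V) : ℕ∞ :=
  ⨅ k ∈ {k : ℕ | HasThresholdCover G k}, (k : ℕ∞)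

/-- The auxiliary graph `G*`: its vertices are the edges of `G`, two of them being adjacent when
they form an alternating 4-cycle in `G`. -/
def auxGraph (G : SimpleGraph V) : SimpleGraph G.edgeSet where
  Adj e f := FormAlternating4Cycle G (e : Sym2 V) (f : Sym2 V)
  symm := ⟨by
    rintro e f ⟨a, b, c, d, he, hf, hab, hcd, had, hbc⟩
    exact ⟨c, d, a, b, hf, he, hcd, hab, hbc.symm, had.symm⟩⟩
  loopless := ⟨by
    rintro e ⟨a, b, c, d, he, hf, hab, hcd, had, hbc⟩
    have h : s(a, b) = s(c, d) := he.symm.trans hf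
    rw [Sym2.eq_iff] at h
    rcases h with ⟨rfl, rfl⟩ | ⟨rfl, rfl⟩
    · exact ((SimpleGraph.compl_adj _ _ _).1 had).2 hab
    · exact had.ne rfl⟩

end ThresholdCover

/-!
A threshold cover of size `k` gives a `k`-colouring of `G*`, as a threshold subgraph of `G`
contains no two edges that form an alternating 4-cycle in `G`. The substance is the converse for
`k = 2`: if `G*` is bipartite, then it has a 2-colouring both of whose colour classes extend to
threshold subgraphs of `G` (`hasThresholdCover_two_of_colorable`).

A set `F` of edges extends to a threshold subgraph if and only if there is no closed walk
alternating between `F` and the non-edges of `G`: in the absence of such walks some vertex is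
isolated for `F` or for the non-edges, and one removes it and proceeds by induction
(`exists_threshold_of_altWalk`). If both colour classes of a colouring are free of alternating
4-cycles, a shortest alternating closed walk in a class has length 6 (`AltWalk.not_closed`). Such
a walk is either a hexagon, which contains an `AltPath`, or has a repeated vertex `p` and traces a
paraglider: two edges `pq`, `pr` and an edge `st` of one colour, with `qr`, `ps`, `pt` non-edges
and `qs`, `qt`, `rs`, `rt` edges of the other colour.

Both are avoided by a canonical choice of the colouring. The vertices are ordered by lexicographic
breadth-first search, and the colours are exchanged on the components of `G*` in such a way that
the lexicographically smallest edge of each component has colour `false`.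

* There is no paraglider whose edge `st` is non-isolated in `G*`, and more generally no `Cone`
  over such an edge (`coneFree_of_lex`). A cone with apexes `q`, `r` over `st` is a cone over the
  whole component of `st`. The edges joining this component to outer vertices that behave like `q`
  form a union of components, and comparing its smallest edge with the smallest edge of the
  component of `st` gives a contradiction. If an outer vertex is adjacent to only a part of the
  component, the component has a very restricted shape (`PartialApex`), and only then the
  breadth-first order is needed.
* In the absence of cones an alternating path can be moved along the component of each of its
  edges (`AltPath.transport`), and comparing the smallest edges of its three components shows that
  there is none (`not_altPath`).
* It remains to recolour the edges that are isolated in `G*`. Each of them can be given a colour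
  that avoids paragliders of a single colour, because two paragliders of different colours over
  the same edge contain an alternating path (`not_paraglider_both`).
-/

namespace ThresholdCover

open Relation

variable {V : Type*} {G : SimpleGraph V} {c : V → V → Bool}

/-! ### Components of the auxiliary graph, cones and alternating paths -/

/-- A 2-colouring of the edges of `G` in which the two edges of every alternating 4-cycle get
different colours, written as a symmetric function on pairs of vertices; the values on
non-adjacent pairs play no role. -/
structure IsProper (G : SimpleGraph V) (c : V → V → Bool) : Prop where
  symm : ∀ a b, c a b = c b a
  ne : ∀ {a b x y}, G.Adj a b → G.Adj x y → Gᶜ.Adj a x → Gᶜ.Adj b y → c a b ≠ c x y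

/-- Adjacency in `G*` for oriented edges: `z w` and `y x` are edges, `z x` and `w y` non-edges.
The orientation is chosen so that a vertex outside the component of `zw` that is adjacent to `z` is
also adjacent to `y`, see `Linked.adj_fst_iff`. -/
def Switch (G : SimpleGraph V) (p q : V × V) : Prop :=
  G.Adj p.1 p.2 ∧ G.Adj q.1 q.2 ∧ Gᶜ.Adj p.1 q.2 ∧ Gᶜ.Adj p.2 q.1

/-- Two oriented edges belong to the same component of `G*`. -/
def Linked (G : SimpleGraph V) : V × V → V × V → Prop :=
  ReflTransGen fun p q => Switch G p q ∨ q = p.swap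

/-- The edge is not an isolated vertex of `G*`. -/
def NonIsolated (G : SimpleGraph V) (p : V × V) : Prop := ∃ q, Switch G p q

theorem Switch.symm {p q : V × V} (h : Switch G p q) : Switch G q p :=
  ⟨h.2.1, h.1, h.2.2.2.symm, h.2.2.1.symm⟩

theorem Switch.swap {p q : V × V} (h : Switch G p q) : Switch G p.swap q.swap :=
  ⟨h.1.symm, h.2.1.symm, h.2.2.2, h.2.2.1⟩

theorem Switch.linked {p q : V × V} (h : Switch G p q) : Linked G p q :=
  ReflTransGen.single (Or.inl h)

theorem linked_refl (p : V × V) : Linked G p p := ReflTransGen.refl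

theorem linked_swap (p : V × V) : Linked G p p.swap := ReflTransGen.single (Or.inr rfl)

theorem Linked.trans {p q r : V × V} (h : Linked G p q) (h' : Linked G q r) : Linked G p r :=
  ReflTransGen.trans h h'

theorem Linked.symm {p q : V × V} (h : Linked G p q) : Linked G q p := by
  induction h with
  | refl => exact linked_refl _
  | tail _ h2 ih =>
    refine ReflTransGen.head ?_ ih
    rcases h2 with h2 | rfl
    · exact Or.inl h2.symm
    · exact Or.inr (by simp)

theorem Linked.swap_right {p q : V × V} (h : Linked G p q) : Linked G p q.swap :=
  h.trans (linked_swap q)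

theorem Linked.swap_left {p q : V × V} (h : Linked G p q) : Linked G p.swap q :=
  (linked_swap p).symm.trans h

/-- Induction along a component of `G*`, for properties stable under reversing an edge. -/
theorem Linked.induction {P : V × V → Prop} {p q : V × V} (h : Linked G p q) (h0 : P p)
    (hswap : ∀ r, P r → P r.swap)
    (hstep : ∀ r s, Linked G p r → Switch G r s → P r → P s) : P q := by
  induction h with
  | refl => exact h0
  | tail h1 h2 ih =>
    rcases h2 with h2 | rfl
    · exact hstep _ _ h1 h2 ih
    · exact hswap _ ih

theorem NonIsolated.swap {p : V × V} (h : NonIsolated G p) : NonIsolated G p.swap :=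
  let ⟨_, hq⟩ := h
  ⟨_, hq.swap⟩

theorem NonIsolated.adj {p : V × V} (h : NonIsolated G p) : G.Adj p.1 p.2 :=
  let ⟨_, hq⟩ := h
  hq.1

theorem NonIsolated.of_linked {p q : V × V} (h : NonIsolated G p) (hpq : Linked G p q) :
    NonIsolated G q :=
  hpq.induction h (fun _ => NonIsolated.swap) fun _ _ _ hrs _ => ⟨_, hrs.symm⟩

theorem IsProper.switch (hc : IsProper G c) {p q : V × V} (h : Switch G p q) :
    c p.1 p.2 = !c q.1 q.2 := by
  have h1 := hc.ne h.1 h.2.1.symm h.2.2.1 h.2.2.2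
  rw [hc.symm q.2 q.1] at h1
  exact Bool.eq_not_of_ne h1

/-- The form in which properness is used: the colours are complementary. -/
theorem IsProper.eq_not (hc : IsProper G c) {a b x y : V} (h1 : G.Adj a b) (h2 : G.Adj x y)
    (h3 : Gᶜ.Adj a x) (h4 : Gᶜ.Adj b y) : c a b = !c x y :=
  Bool.eq_not_of_ne (hc.ne h1 h2 h3 h4)

/-- If `ab` and `xy` have the same colour and `a x` is a non-edge, then `b y` is not a non-edge. -/
theorem IsProper.adj_of_eq (hc : IsProper G c) {a b x y : V} (h1 : G.Adj a b) (h2 : G.Adj x y)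
    (h3 : Gᶜ.Adj a x) (h4 : c a b = c x y) (hne : b ≠ y) : G.Adj b y := by
  by_contra h
  exact hc.ne h1 h2 h3 ((SimpleGraph.compl_adj _ _ _).2 ⟨hne, h⟩) h4

theorem compl_of {a b : V} (h : a ≠ b) (h' : ¬ G.Adj a b) : Gᶜ.Adj a b :=
  (SimpleGraph.compl_adj _ _ _).2 ⟨h, h'⟩

theorem not_adj_of {a b : V} (h : Gᶜ.Adj a b) : ¬ G.Adj a b :=
  ((SimpleGraph.compl_adj _ _ _).1 h).2

theorem ne_of_adj_compl {a b x : V} (h : G.Adj a x) (h' : Gᶜ.Adj b x) : a ≠ b := by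
  rintro rfl
  exact not_adj_of h' h

/-- A non-adjacent pair `q, r` completely joined to the ends of the edge `st`, all four joining
edges having the colour opposite to that of `st`. The vertices `q`, `r` are the apexes, and the
vertices of the component of `st` in `G*` form the base. If `st` switches to `yx`, then `st`, `yq`,
`rx` are the edges of an alternating 6-cycle of a single colour. -/
structure Cone (G : SimpleGraph V) (c : V → V → Bool) (q r s t : V) : Prop where
  compl : Gᶜ.Adj q r
  adj : G.Adj s t
  qs : G.Adj q s
  qt : G.Adj q t
  rs : G.Adj r s
  rt : G.Adj r t
  cqs : c q s = !c s t
  cqt : c q t = !c s t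
  crs : c r s = !c s t
  crt : c r t = !c s t

theorem Cone.swap {q r s t : V} (hc : IsProper G c) (h : Cone G c q r s t) : Cone G c q r t s :=
  ⟨h.1, h.2.symm, h.4, h.3, h.6, h.5, by rw [h.cqt, hc.symm s t], by rw [h.cqs, hc.symm s t],
    by rw [h.crt, hc.symm s t], by rw [h.crs, hc.symm s t]⟩

theorem Cone.switch (hc : IsProper G c) {q r s t y x : V} (h : Cone G c q r s t)
    (hs : Switch G (s, t) (y, x)) : Cone G c q r y x := by
  obtain ⟨hst, hyx, hsx, hty⟩ := hs
  dsimp only at hst hyx hsx hty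
  have hcol : c s t = !c y x := hc.switch (p := (s, t)) (q := (y, x)) ⟨hst, hyx, hsx, hty⟩
  have key : ∀ p o s t y x : V, Gᶜ.Adj p o → G.Adj p s → G.Adj p t → G.Adj o s →
      c p t = !c s t → c o s = !c s t → G.Adj y x → Gᶜ.Adj s x → Gᶜ.Adj t y →
      c s t = !c y x → G.Adj p x ∧ c p x = !c y x := by
    intro p o s t y x hpo hps hpt hos h1 h2 hyx hsx hty hcol
    have hpx : G.Adj p x := by
      refine hc.adj_of_eq hpt.symm hyx hty ?_ (ne_of_adj_compl hps hsx.symm)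
      rw [hc.symm, h1, hcol, Bool.not_not]
    refine ⟨hpx, ?_⟩
    rw [hc.eq_not hpx hos hpo hsx.symm, h2, hcol]
    simp
  have hcol' : c t s = !c x y := by rw [hc.symm t s, hc.symm x y, hcol]
  have h' := h.swap hc
  obtain ⟨a1, b1⟩ := key q r s t y x h.1 h.3 h.4 h.5 h.cqt h.crs hyx hsx hty hcol
  obtain ⟨a2, b2⟩ := key r q s t y x h.1.symm h.5 h.6 h.3 h.crt h.cqs hyx hsx hty hcol
  obtain ⟨a3, b3⟩ := key q r t s x y h.1 h.4 h.3 h.6 h'.cqt h'.crs hyx.symm hty hsx hcol'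
  obtain ⟨a4, b4⟩ := key r q t s x y h.1.symm h.6 h.5 h.4 h'.crt h'.cqs hyx.symm hty hsx hcol'
  exact ⟨h.1, hyx, a3, a1, a4, a2, by rw [b3, hc.symm], b1, by rw [b4, hc.symm], b2⟩

theorem Cone.linked (hc : IsProper G c) {q r s t : V} {p : V × V} (h : Cone G c q r s t)
    (hs : Linked G (s, t) p) : Cone G c q r p.1 p.2 :=
  hs.induction (P := fun p => Cone G c q r p.1 p.2) h (fun _ h => h.swap hc)
    fun _ _ _ hrs h => h.switch hc hrs

/-- A path `a z w b` with non-adjacent ends and alternating colours, none of whose edges is isolated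
in `G*`. If `zw` switches to an edge `yx`, then `az`, `xy`, `wb` are the edges of an alternating
closed walk of length 6 of a single colour. -/
structure AltPath (G : SimpleGraph V) (c : V → V → Bool) (a z w b : V) : Prop where
  compl : Gᶜ.Adj a b
  ncol₁ : c a z = !c z w
  ncol₂ : c w b = !c z w
  non₁ : NonIsolated G (a, z)
  non₂ : NonIsolated G (z, w)
  non₃ : NonIsolated G (w, b)

theorem AltPath.reverse (hc : IsProper G c) {a z w b : V} (h : AltPath G c a z w b) :
    AltPath G c b w z a :=
  ⟨h.1.symm, by rw [hc.symm, h.3, hc.symm z], by rw [hc.symm, h.2, hc.symm z], h.6.swap, h.5.swap,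
    h.4.swap⟩

/-- `G` has no `Cone` over an edge that is not isolated in `G*`. -/
def ConeFree (G : SimpleGraph V) (c : V → V → Bool) : Prop :=
  ∀ q r s t, Cone G c q r s t → ¬ NonIsolated G (s, t)

/-- A degenerate move of an alternating path produces a cone. -/
theorem AltPath.cone (hc : IsProper G c) {a z w b x : V} (h : AltPath G c a z w b)
    (hs : Switch G (z, w) (a, x)) : Cone G c z x w b := by
  obtain ⟨hzw, hax, hzx, hwa⟩ := hs
  dsimp only at hzw hax hzx hwa
  have haz : G.Adj a z := h.non₁.adj
  have hwb : G.Adj w b := h.non₃.adj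
  have hab := h.compl
  have c1 : c z w = !c a x := hc.switch (p := (z, w)) (q := (a, x)) ⟨hzw, hax, hzx, hwa⟩
  have c2 := h.ncol₁
  have c3 := h.ncol₂
  have hzb : G.Adj z b := hc.adj_of_eq haz hwb hwa.symm (by rw [c2, c3]) (by
    rintro rfl; exact not_adj_of hab haz)
  have hxb : G.Adj x b := hc.adj_of_eq hax hwb hwa.symm (by rw [c3, c1]; simp) (by
    rintro rfl; exact not_adj_of hab hax)
  have hxw : G.Adj x w := hc.adj_of_eq hax hwb.symm hab (by rw [hc.symm b w, c3, c1]; simp) (by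
    rintro rfl; exact not_adj_of hwa hax.symm)
  refine ⟨hzx, hwb, hzw, hzb, hxw, hxb, by rw [c3]; simp, ?_, ?_, ?_⟩
  · rw [hc.eq_not hzb hax.symm hzx hab.symm, c3, c1, hc.symm x a]; simp
  · rw [hc.eq_not hxw haz.symm hzx.symm hwa, hc.symm z a, c2, c3]
  · rw [hc.eq_not hxb haz.symm hzx.symm hab.symm, hc.symm z a, c2, c3]

theorem AltPath.switch (hc : IsProper G c) (hD : ConeFree G c) {a z w b y x : V}
    (h : AltPath G c a z w b) (hs : Switch G (z, w) (y, x)) :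
    AltPath G c a y x b ∧ Linked G (a, y) (w, b) ∧ Linked G (x, b) (a, z) := by
  have hya : y ≠ a := by
    rintro rfl
    exact hD _ _ _ _ (h.cone hc hs) h.non₃
  have hxb : x ≠ b := by
    rintro rfl
    exact hD _ _ _ _ ((h.reverse hc).cone hc hs.swap) h.non₁.swap
  obtain ⟨hzw, hyx, hzx, hwy⟩ := id hs
  dsimp only at hzw hyx hzx hwy
  have haz : G.Adj a z := h.non₁.adj
  have hwb : G.Adj w b := h.non₃.adj
  have hab := h.compl
  have c1 : c z w = !c y x := hc.switch hs
  have c2 := h.ncol₁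
  have c3 := h.ncol₂
  have hay : G.Adj a y := hc.adj_of_eq haz.symm hyx.symm hzx
    (by rw [hc.symm z a, c2, c1, hc.symm x y]; simp) hya.symm
  have hxb' : G.Adj x b := (hc.adj_of_eq hwb hyx hwy (by rw [c3, c1]; simp) hxb.symm).symm
  have s1 : Switch G (a, y) (w, b) := ⟨hay, hwb, hab, hwy.symm⟩
  have s2 : Switch G (x, b) (a, z) := ⟨hxb', haz, hzx.symm, hab.symm⟩
  refine ⟨⟨hab, ?_, ?_, ⟨_, s1⟩, ⟨_, hs.symm⟩, ⟨_, s2⟩⟩, s1.linked, s2.linked⟩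
  · have := hc.switch s1
    dsimp only at this
    rw [this, c3, c1]; simp
  · have := hc.switch s2
    dsimp only at this
    rw [this, c2, c1]; simp

/-- An alternating path with fixed ends `a, b` can be moved along the whole component of its middle
edge, the outer edges staying in their components (possibly exchanging them). -/
theorem AltPath.transport (hc : IsProper G c) (hD : ConeFree G c) {a z w b : V}
    (h : AltPath G c a z w b) {p : V × V} (hp : Linked G (z, w) p) :
    ∃ x y, (p = (x, y) ∨ p = (y, x)) ∧ AltPath G c a x y b ∧
      ((Linked G (a, z) (a, x) ∧ Linked G (w, b) (y, b)) ∨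
        (Linked G (w, b) (a, x) ∧ Linked G (a, z) (y, b))) := by
  refine hp.induction (P := fun p => ∃ x y, (p = (x, y) ∨ p = (y, x)) ∧ AltPath G c a x y b ∧
      ((Linked G (a, z) (a, x) ∧ Linked G (w, b) (y, b)) ∨
        (Linked G (w, b) (a, x) ∧ Linked G (a, z) (y, b)))) ?_ ?_ ?_
  · exact ⟨z, w, Or.inl rfl, h, Or.inl ⟨linked_refl _, linked_refl _⟩⟩
  · rintro r ⟨x, y, hr, h⟩
    refine ⟨x, y, ?_, h⟩
    rcases hr with rfl | rfl
    · exact Or.inr rfl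
    · exact Or.inl rfl
  · rintro r ⟨s, t⟩ - hrs ⟨x, y, hr, h, hl⟩
    have key : ∀ s t, Switch G (x, y) (s, t) → AltPath G c a s t b ∧
      ((Linked G (a, z) (a, s) ∧ Linked G (w, b) (t, b)) ∨
        (Linked G (w, b) (a, s) ∧ Linked G (a, z) (t, b))) := by
      intro s t hst
      obtain ⟨h1, h2, h3⟩ := h.switch hc hD hst
      refine ⟨h1, ?_⟩
      rcases hl with ⟨l1, l2⟩ | ⟨l1, l2⟩
      · exact Or.inr ⟨l2.trans h2.symm, l1.trans h3.symm⟩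
      · exact Or.inl ⟨l2.trans h2.symm, l1.trans h3.symm⟩
    rcases hr with rfl | rfl
    · exact ⟨s, t, Or.inl rfl, key s t hrs⟩
    · exact ⟨t, s, Or.inr rfl, key t s hrs.swap⟩

theorem AltPath.rotate (hc : IsProper G c) (hD : ConeFree G c) {a z w b : V}
    (h : AltPath G c a z w b) : ∃ y, AltPath G c w z a y ∧ Linked G (w, b) (a, y) := by
  obtain ⟨⟨y, x⟩, hs⟩ := h.non₂
  obtain ⟨h1, h2, -⟩ := h.switch hc hD hs
  have c1 : c z w = !c y x := hc.switch hs
  have c2 := h.ncol₁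
  have c3 := h1.ncol₁
  refine ⟨y, ⟨hs.2.2.2, ?_, ?_, h.non₂.swap, h.non₁.swap, h1.non₁⟩, h2.symm⟩
  · rw [hc.symm z a, c2, hc.symm w z]; simp
  · rw [hc.symm z a, c2, c3, c1]; simp

/-! ### Lexicographic exclusion of alternating paths -/

/-- The lexicographically smallest oriented edge of every component of `G*` has colour `false`. -/
def LexMinFalse [LinearOrder V] (G : SimpleGraph V) (c : V → V → Bool) : Prop :=
  ∀ p : V × V, G.Adj p.1 p.2 → ∃ m, Linked G p m ∧ c m.1 m.2 = false ∧
    ∀ q, Linked G p q → toLex m ≤ toLex q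

/-- If `v` is the smallest vertex of the component of `vk`, then the smallest edge of that component
is some `vs`. -/
theorem LexMinFalse.exists_le [LinearOrder V] (hlex : LexMinFalse G c) {v k : V}
    (hvk : G.Adj v k) (hmin : ∀ p, Linked G (v, k) p → v ≤ p.1) :
    ∃ s ≤ k, Linked G (v, k) (v, s) ∧ c v s = false := by
  obtain ⟨⟨m1, m2⟩, hm, hcm, hle⟩ := hlex (v, k) hvk
  have h1 := hmin _ hm
  have h2 := hle _ (linked_refl _)
  rw [Prod.Lex.toLex_le_toLex] at h2
  dsimp only at h1 h2
  rcases h2 with h2 | ⟨rfl, h2⟩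
  · exact absurd h1 (not_le.2 h2)
  · exact ⟨m2, h2, hm, hcm⟩

/-- No edge at `z` belongs to the component of `wb`: moving `wb` along its component, one end stays
adjacent to `z`, by an edge of a colour different from that of the moved edge. -/
theorem AltPath.not_linked (hc : IsProper G c) (hD : ConeFree G c) {a z w b k : V}
    (h : AltPath G c a z w b) : ¬ Linked G (w, b) (z, k) := by
  intro hk
  obtain ⟨y, hy, -⟩ := (h.reverse hc).rotate hc hD
  obtain ⟨x, x', hx, hp, -⟩ := hy.transport hc hD hk
  rcases hx with hx | hx <;> obtain ⟨rfl, rfl⟩ := Prod.ext_iff.1 hx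
  · exact G.loopless.irrefl _ hp.non₁.adj
  · have := hp.ncol₁
    rw [hc.symm] at this
    simp at this

/-- Lexicographic exclusion of alternating paths. Let `v` be the smallest vertex that is an inner
vertex of one. The smallest edges of the two components at `v` are `vs` and `vs'`, and moving the
path to them places `ss'` in the third component, below the smallest edge of that component. -/
theorem not_altPath [LinearOrder V] [Finite V] (hc : IsProper G c) (hD : ConeFree G c)
    (hlex : LexMinFalse G c) (a z w b : V) : ¬ AltPath G c a z w b := by
  intro h0
  obtain ⟨v, ⟨a, w, b, h⟩, hv⟩ := (Finite.to_wellFoundedLT (α := V)).wf.has_min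
    {z | ∃ a w b, AltPath G c a z w b} ⟨z, a, w, b, h0⟩
  replace hv : ∀ a z w b, AltPath G c a z w b → v ≤ z := fun a z w b h =>
    not_lt.1 (hv z ⟨a, w, b, h⟩)
  have hv' : ∀ a z w b, AltPath G c a z w b → ∀ p, Linked G (z, w) p → v ≤ p.1 := by
    intro a z w b h p hp
    obtain ⟨x, y, hxy, hq, -⟩ := h.transport hc hD hp
    rcases hxy with rfl | rfl
    · exact hv _ _ _ _ hq
    · exact hv _ _ _ _ (hq.reverse hc)
  -- Move the path so that its edge avoiding `v` is the smallest one of its component.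
  obtain ⟨y, hy, -⟩ := (h.reverse hc).rotate hc hD
  obtain ⟨m, hm, hcm, hle⟩ := hlex (w, b) hy.non₂.adj
  obtain ⟨v₃, v₂, hx, hp, -⟩ := hy.transport hc hD hm
  have hle' : ∀ s s' : V, s < v₃ → s' < v₂ → ¬ Linked G (v₃, v₂) (s, s') := by
    intro s s' hs hs' hl
    rcases hx with rfl | rfl
    · have := hle _ (hm.trans hl)
      rw [Prod.Lex.toLex_le_toLex] at this
      rcases this with h | ⟨h, -⟩
      · exact lt_asymm h hs
      · exact hs.ne' h
    · have := hle _ (hm.trans hl.swap_left.swap_right)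
      rw [Prod.Lex.toLex_le_toLex] at this
      rcases this with h | ⟨h, -⟩
      · exact lt_asymm h hs'
      · exact hs'.ne' h
  have hcol : c v₃ v₂ = false := by
    rcases hx with rfl | rfl
    · exact hcm
    · rw [hc.symm]; exact hcm
  obtain ⟨v₁, hq, -⟩ := hp.rotate hc hD
  replace hq := hq.reverse hc
  have e1 : c v v₃ = true := by
    have := hq.ncol₂
    rw [hcol] at this
    simpa using this.symm
  have e2 : c v₁ v = false := by rw [hq.ncol₁, e1]; rfl
  -- The smallest edge `v s` of the component of `v v₃`.
  obtain ⟨s, hs, hls, hcs⟩ := hlex.exists_le hq.non₂.adj (hv' _ _ _ _ hq)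
  replace hs : s < v₃ := lt_of_le_of_ne hs (by rintro rfl; simp [e1] at hcs)
  obtain ⟨x, x', hxx, hr, hlr⟩ := hq.transport hc hD hls
  rcases hxx with hxx | hxx <;> obtain ⟨rfl, rfl⟩ := Prod.ext_iff.1 hxx
  · have := hr.ncol₁
    simp [e2, hcs] at this
  have hl1 : Linked G (v₃, v₂) (v₁, s) := by
    rcases hlr with ⟨-, h2⟩ | ⟨h1, -⟩
    · exact absurd h2 (hq.not_linked hc hD)
    · exact h1
  have e3 : c v v₂ = true := by
    have := hr.ncol₂
    rw [hc.symm s, hcs] at this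
    simpa using this
  -- The smallest edge `v s'` of the component of `v v₂`.
  obtain ⟨x, hx', hlx⟩ := (hr.reverse hc).rotate hc hD
  obtain ⟨s', hs', hls', hcs'⟩ := hlex.exists_le hr.non₃.adj
    (hv' _ _ _ _ hx')
  replace hs' : s' < v₂ := lt_of_le_of_ne hs' (by rintro rfl; simp [e3] at hcs')
  obtain ⟨y, y', hyy, ht, hlt⟩ := hx'.transport hc hD hls'
  rcases hyy with hyy | hyy <;> obtain ⟨rfl, rfl⟩ := Prod.ext_iff.1 hyy
  · have := ht.ncol₁
    rw [hc.symm s, hcs, hcs'] at this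
    simp at this
  have hl2 : Linked G (v₃, v₂) (s, s') := by
    rcases hlt with ⟨-, h2⟩ | ⟨h1, -⟩
    · exact absurd (hl1.trans ((hlx.swap_left).trans h2)) (hq.not_linked hc hD)
    · exact (hl1.trans (hlx.swap_left)).trans h1
  exact hle' s s' hs hs' hl2

/-! ### The base of a cone and its outer vertices -/

/-- The vertices incident with the component of `G*` that contains the edge `e`. -/
def Span (G : SimpleGraph V) (e : V × V) (z : V) : Prop := ∃ w, Linked G e (z, w)

theorem Linked.span_fst {e : V × V} {z w : V} (h : Linked G e (z, w)) : Span G e z := ⟨w, h⟩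

theorem Linked.span_snd {e : V × V} {z w : V} (h : Linked G e (z, w)) : Span G e w :=
  ⟨z, h.swap_right⟩

/-- A vertex outside a component does not distinguish `z` from `y` when `zw` switches to `yx`. -/
theorem Linked.adj_fst_iff {e : V × V} {z w y x t : V} (h : Linked G e (z, w))
    (hs : Switch G (z, w) (y, x)) (ht : ¬ Span G e t) : G.Adj t z ↔ G.Adj t y := by
  have key : ∀ z w y x, Linked G e (z, w) → Switch G (z, w) (y, x) → G.Adj t z → G.Adj t y := by
    intro z w y x h hs htz
    by_contra hty
    have hyx : Linked G e (y, x) := h.trans hs.linked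
    have hne : t ≠ y := by
      rintro rfl
      exact ht hyx.span_fst
    have : Switch G (x, y) (t, z) := ⟨hs.2.1.symm, htz, hs.2.2.1.symm, (compl_of hne hty).symm⟩
    exact ht (hyx.swap_right.trans this.linked).span_fst
  exact ⟨key z w y x h hs, key y x z w (h.trans hs.linked) hs.symm⟩

section Cone

variable {q r : V} {e : V × V} (hc : IsProper G c) (hC : Cone G c q r e.1 e.2)
include hc hC

theorem Cone.adj_span {k : V} (hk : Span G e k) : G.Adj q k :=
  let ⟨_, h⟩ := hk
  (hC.linked hc h).qs

theorem Cone.col_span {k : V} (hk : Span G e k) : c q k = c r k := by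
  obtain ⟨l, h⟩ := hk
  have h' := hC.linked hc h
  rw [h'.cqs, h'.crs]

theorem Cone.col_linked {k l : V} (h : Linked G e (k, l)) : c k l = !c q k := by
  rw [(hC.linked hc h).cqs]; simp

theorem Cone.col_eq {k l : V} (h : Linked G e (k, l)) : c q k = c q l := by
  have h' := hC.linked hc h
  rw [h'.cqs, h'.cqt]

/-- Non-adjacent vertices of the base of a cone are joined to its apex by different colours. -/
theorem Cone.col_compl {k l : V} (hk : Span G e k) (hl : Span G e l) (h : Gᶜ.Adj k l) :
    c q l = !c q k := by
  have hrl : G.Adj r l := let ⟨_, h⟩ := hl; (hC.linked hc h).rs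
  rw [hC.col_span hc hl, hc.eq_not hrl (hC.adj_span hc hk) hC.compl.symm h.symm]

theorem Cone.not_span_apex : ¬ Span G e q := fun h => G.loopless.irrefl _ (hC.adj_span hc h)

end Cone

/-- Every vertex `k` of a non-trivial component has a non-neighbour `x` and a
companion `y` in it. -/
theorem NonIsolated.partner {e : V × V} (he : NonIsolated G e) {k : V} (hk : Span G e k) :
    ∃ w y x, Linked G e (k, w) ∧ Switch G (k, w) (y, x) ∧ Linked G e (y, x) := by
  obtain ⟨w, h⟩ := hk
  obtain ⟨⟨y, x⟩, hs⟩ := he.of_linked h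
  exact ⟨w, y, x, h, hs, h.trans hs.linked⟩

/-- A bipartition of the vertices of the component of `e` that is crossed by every edge of the
component and respected by the switches. -/
structure Sides (G : SimpleGraph V) (e : V × V) (S : V → Prop) : Prop where
  cross : ∀ {z w}, Linked G e (z, w) → (S z ↔ ¬ S w)
  link : ∀ {z w y x}, Linked G e (z, w) → Switch G (z, w) (y, x) → (S z ↔ S y)

/-- Each side is connected through switches. -/
theorem Sides.induction {e : V × V} {S P : V → Prop} (hS : Sides G e S) {k₀ : V}
    (hk₀ : Span G e k₀) (h0 : P k₀)
    (step : ∀ z w y x, Linked G e (z, w) → Switch G (z, w) (y, x) → (S z ↔ S k₀) → P z → P y)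
    {k : V} (hk : Span G e k) (hkS : S k ↔ S k₀) : P k := by
  obtain ⟨l₀, hl₀⟩ := hk₀
  obtain ⟨l, hl⟩ := hk
  refine ((hl₀.symm.trans hl).induction
    (P := fun p => ((S p.1 ↔ S k₀) → P p.1) ∧ ((S p.2 ↔ S k₀) → P p.2)) ⟨fun _ => h0, ?_⟩
    (fun _ h => ⟨h.2, h.1⟩) ?_).1 hkS
  · intro h
    have := hS.cross hl₀
    dsimp only at h
    tauto
  · rintro ⟨z, w⟩ ⟨y, x⟩ hr hs ⟨h1, h2⟩
    have hr' := hl₀.trans hr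
    refine ⟨fun h => ?_, fun h => ?_⟩
    · have hz := (hS.link hr' hs).trans h
      exact step z w y x hr' hs hz (h1 hz)
    · have hw := (hS.link hr'.swap_right hs.swap).trans h
      exact step w z x y hr'.swap_right hs.swap hw (h2 hw)

/-- A vertex outside the component does not distinguish vertices on the same side. -/
theorem Sides.adj_iff {e : V × V} {S : V → Prop} (hS : Sides G e S) {t k l : V}
    (ht : ¬ Span G e t) (hk : Span G e k) (hl : Span G e l) (h : S k ↔ S l) :
    G.Adj t k ↔ G.Adj t l := by
  refine hS.induction (P := fun k => G.Adj t k ↔ G.Adj t l) hl Iff.rfl ?_ hk h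
  intro z w y x hzw hs _ hz
  rw [← hzw.adj_fst_iff hs ht, hz]

/-- A vertex outside a component that is adjacent to some but not all of its vertices
bipartitions the component. -/
theorem sides_of_partial {e : V × V} {t k l : V} (ht : ¬ Span G e t) (hk : Span G e k)
    (hl : Span G e l) (htk : G.Adj t k) (htl : ¬ G.Adj t l) : Sides G e (G.Adj t) := by
  have link : ∀ {z w y x}, Linked G e (z, w) → Switch G (z, w) (y, x) →
      (G.Adj t z ↔ G.Adj t y) := fun h hs => h.adj_fst_iff hs ht
  refine ⟨?_, link⟩
  intro z w hzw
  by_cases hz : G.Adj t z <;> by_cases hw : G.Adj t w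
  · exfalso
    obtain ⟨m, hm⟩ := hl
    refine htl ((hzw.symm.trans hm).induction (P := fun p => G.Adj t p.1 ∧ G.Adj t p.2)
      ⟨hz, hw⟩ (fun _ h => ⟨h.2, h.1⟩) ?_).1
    rintro ⟨a, b⟩ ⟨a', b'⟩ hr hs ⟨h1, h2⟩
    exact ⟨(link (hzw.trans hr) hs).1 h1, (link (hzw.trans hr).swap_right hs.swap).1 h2⟩
  · tauto
  · tauto
  · exfalso
    obtain ⟨m, hm⟩ := hk
    refine ((hzw.symm.trans hm).induction (P := fun p => ¬ G.Adj t p.1 ∧ ¬ G.Adj t p.2)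
      ⟨hz, hw⟩ (fun _ h => ⟨h.2, h.1⟩) ?_).1 htk
    rintro ⟨a, b⟩ ⟨a', b'⟩ hr hs ⟨h1, h2⟩
    exact ⟨fun h => h1 ((link (hzw.trans hr) hs).2 h),
      fun h => h2 ((link (hzw.trans hr).swap_right hs.swap).2 h)⟩

/-- A vertex `t` outside the base of a cone with apex `q` that is adjacent to part of the base only,
the edges to the base being coloured like those of `q`. -/
structure PartialApex (G : SimpleGraph V) (c : V → V → Bool) (q : V) (e : V × V) (t : V) :
    Prop where
  not_span : ¬ Span G e t
  near : ∃ k, Span G e k ∧ G.Adj t k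
  far : ∃ k, Span G e k ∧ ¬ G.Adj t k
  col : ∀ k, Span G e k → G.Adj t k → c t k = c q k

namespace PartialApex

variable {q r t : V} {e : V × V} (hc : IsProper G c) (hC : Cone G c q r e.1 e.2)
  (he : NonIsolated G e) (ht : PartialApex G c q e t)

include ht in
theorem sides : Sides G e (G.Adj t) := by
  obtain ⟨k, hk, htk⟩ := ht.near
  obtain ⟨l, hl, htl⟩ := ht.far
  exact sides_of_partial ht.not_span hk hl htk htl

include ht in
theorem compl {k : V} (hk : Span G e k) (h : ¬ G.Adj t k) : Gᶜ.Adj t k :=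
  compl_of (by rintro rfl; exact ht.not_span hk) h

include hc hC he ht

/-- The side of the base that is not adjacent to a partial apex is independent: an edge `xk` inside
it would force `x` to be adjacent to the whole side, hence to itself. -/
theorem not_adj {x k : V} (hx : Span G e x) (hk : Span G e k) (htx : ¬ G.Adj t x)
    (htk : ¬ G.Adj t k) : ¬ G.Adj x k := by
  have hS := ht.sides
  have col : ∀ k, Span G e k → ¬ G.Adj t k → G.Adj x k → c x k = c q k := by
    intro k hk htk hxk
    obtain ⟨w, y, k', h1, hs, h2⟩ := he.partner hk
    have hk' : G.Adj t k' := by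
      have := hS.cross h2
      have := hS.link h1 hs
      tauto
    rw [hc.eq_not hxk hk' (ht.compl hx htx).symm hs.2.2.1, ht.col k' h2.span_snd hk',
      hC.col_compl hc hk h2.span_snd hs.2.2.1]
    simp
  intro hxk
  refine G.loopless.irrefl x (hS.induction (P := G.Adj x) hk hxk ?_ hx (by tauto))
  intro y y₂ y₂' y' hy hs hyS hxy
  have hy' : Linked G e (y₂', y') := hy.trans hs.linked
  have hty : ¬ G.Adj t y := by tauto
  have hty₂ : G.Adj t y₂ := by
    have := hS.cross hy
    tauto
  have c1 := col y hy.span_fst hty hxy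
  have c2 : c y₂' y' = c q y := by
    rw [hC.col_linked hc hy', ← hC.col_eq hc hy'.swap_right,
      hC.col_compl hc hy.span_fst hy'.span_snd hs.2.2.1]
    simp
  by_cases hxe : x = y₂'
  · subst hxe
    exfalso
    have h3 := hc.eq_not hxy.symm hty₂ (ht.compl hy.span_fst hty).symm hs.2.2.2.symm
    rw [hc.symm y x, c1, ht.col _ hy.span_snd hty₂, hC.col_eq hc hy] at h3
    simp at h3
  · refine hc.adj_of_eq hxy.symm hs.2.1.symm hs.2.2.1 ?_ hxe
    rw [hc.symm y x, hc.symm y' y₂', c1, c2]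

/-- The side of the base not adjacent to a partial apex has one vertex of each colour. -/
theorem eq_of_col_eq {x k : V} (hx : Span G e x) (hk : Span G e k) (htx : ¬ G.Adj t x)
    (htk : ¬ G.Adj t k) (h : c q x = c q k) : x = k := by
  by_contra hne
  have := hC.col_compl hc hx hk (compl_of hne (ht.not_adj hc hC he hx hk htx htk))
  simp [h] at this

theorem compl_of_col_ne {k l : V} (hk : Span G e k) (hl : Span G e l) (htk : G.Adj t k)
    (htl : ¬ G.Adj t l) (h : c q k ≠ c q l) : Gᶜ.Adj k l := by
  have hS := ht.sides
  obtain ⟨w, y, x, h1, hs, h2⟩ := he.partner hk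
  have hx : ¬ G.Adj t x := by
    have := hS.cross h2
    have := hS.link h1 hs
    tauto
  have hcol := hC.col_compl hc hk h2.span_snd hs.2.2.1
  rw [← ht.eq_of_col_eq hc hC he h2.span_snd hl hx htl (by rw [hcol, Bool.eq_not_of_ne h]; simp)]
  exact hs.2.2.1

theorem linked_of_col_eq {k l : V} (hk : Span G e k) (hl : Span G e l) (htk : G.Adj t k)
    (htl : ¬ G.Adj t l) (h : c q k = c q l) : Linked G e (k, l) := by
  obtain ⟨w, hw⟩ := id hk
  have htw : ¬ G.Adj t w := (ht.sides.cross hw).1 htk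
  rwa [← ht.eq_of_col_eq hc hC he hw.span_snd hl htw htl (by rw [← hC.col_eq hc hw, h])]

/-- An outer vertex adjacent to a vertex on the far side of a partial apex is adjacent to the
whole near side. -/
theorem adj_near {s k l : V} (hs : ¬ Span G e s) (hk : Span G e k) (hl : Span G e l)
    (htk : G.Adj t k) (htl : ¬ G.Adj t l) (hsl : G.Adj s l) : G.Adj s k := by
  by_contra hsk
  have hne : ∀ {k}, Span G e k → s ≠ k := by rintro k hk rfl; exact hs hk
  obtain ⟨w, y, x, h1, hsw, h2⟩ := he.partner hk
  have hty : G.Adj t y := (ht.sides.link h1 hsw).1 htk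
  have hsy : ¬ G.Adj s y := fun h => hsk ((h1.adj_fst_iff hsw hs).2 h)
  have e1 := hc.eq_not hsl htk.symm (compl_of (hne hk) hsk) (ht.compl hl htl).symm
  have e2 := hc.eq_not hsl hty.symm (compl_of (hne h2.span_fst) hsy) (ht.compl hl htl).symm
  rw [hc.symm k t, ht.col k hk htk] at e1
  rw [hc.symm y t, ht.col y h2.span_fst hty, hC.col_eq hc h2,
    hC.col_compl hc hk h2.span_snd hsw.2.2.1, e1] at e2
  simp at e2

end PartialApex

/-! ### Lexicographic exclusion of cones -/

/-- An edge `wz` from a vertex `w` outside the component of `e` to a vertex `z` of it, such that `w`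
is adjacent to every vertex `k` of it with `S k ↔ S z`, by an edge coloured like `qk`. The predicate
`S` is either constant or the bipartition given by a partial apex. -/
structure GoodEdge (G : SimpleGraph V) (c : V → V → Bool) (q : V) (e : V × V) (S : V → Prop)
    (w z : V) : Prop where
  not_span : ¬ Span G e w
  span : Span G e z
  adj : ∀ k, Span G e k → (S k ↔ S z) → G.Adj w k
  col : ∀ k, Span G e k → (S k ↔ S z) → c w k = c q k

section

variable {q r : V} {e : V × V} {S : V → Prop} (hc : IsProper G c)
  (hC : Cone G c q r e.1 e.2) (he : NonIsolated G e)
include hc hC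

theorem Cone.goodEdge {z : V} (hz : Span G e z) : GoodEdge G c q e S q z :=
  ⟨hC.not_span_apex hc, hz, fun _ hk _ => hC.adj_span hc hk, fun _ _ _ => rfl⟩

/-- The colour of `xk` is forced by an edge `wk'` with `wx` and `kk'` non-edges. -/
theorem Cone.col_of_compl {w x k k' : V} (hk : Span G e k) (hk' : Span G e k')
    (hkk : Gᶜ.Adj k k') (hwx : Gᶜ.Adj w x) (hxk : G.Adj x k) (hwk : G.Adj w k')
    (hcol : c w k' = c q k') : c x k = c q k := by
  rw [hc.eq_not hxk hwk hwx.symm hkk, hcol, hC.col_compl hc hk hk' hkk]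
  simp

include he in
/-- A switch of a good edge `wz` leads to an edge that meets the component, too. -/
theorem GoodEdge.span_of_switch {w z y x : V} (h : GoodEdge G c q e S w z)
    (link : ∀ {z w y x}, Linked G e (z, w) → Switch G (z, w) (y, x) → (S z ↔ S y))
    (hs : Switch G (w, z) (y, x)) : Span G e y := by
  by_contra hy
  obtain ⟨z₂, y₂, z', h1, hs', h2⟩ := he.partner h.span
  have hS := link h1 hs'
  have hyz : ¬ G.Adj y z := not_adj_of hs.2.2.2.symm
  have hy₂ : ¬ G.Adj y y₂ := fun h => hyz ((h1.adj_fst_iff hs' hy).2 h)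
  have hne : y₂ ≠ y := by rintro rfl; exact hy h2.span_fst
  have e1 := hc.eq_not hs.1 hs.2.1.symm hs.2.2.1 hs.2.2.2
  have e2 := hc.eq_not (h.adj y₂ h2.span_fst hS.symm) hs.2.1.symm hs.2.2.1
    (compl_of hne fun h => hy₂ h.symm)
  dsimp only at e1 e2
  rw [h.col z h.span Iff.rfl] at e1
  rw [h.col y₂ h2.span_fst hS.symm, hC.col_eq hc h2,
    hC.col_compl hc h.span h2.span_snd hs'.2.2.1, e1] at e2
  simp at e2

include he in
/-- Without partial apexes, the edges to the base from vertices joined to it like `q` form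
a union of components. -/
theorem GoodEdge.switch_of_forall (hno : ∀ t, ¬ PartialApex G c q e t) {w z y x : V}
    (h : GoodEdge G c q e (fun _ => True) w z) (hs : Switch G (w, z) (y, x)) :
    GoodEdge G c q e (fun _ => True) x y := by
  have hy := h.span_of_switch hc hC he (fun _ _ => Iff.rfl) hs
  have hx : ¬ Span G e x := fun hx => not_adj_of hs.2.2.1 (h.adj x hx Iff.rfl)
  have col : ∀ k, Span G e k → G.Adj x k → c x k = c q k := by
    intro k hk hxk
    obtain ⟨_, _, k', _, hs', h2⟩ := he.partner hk
    exact hC.col_of_compl hc hk h2.span_snd hs'.2.2.1 hs.2.2.1 hxk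
      (h.adj k' h2.span_snd Iff.rfl) (h.col k' h2.span_snd Iff.rfl)
  have adj : ∀ k, Span G e k → G.Adj x k := by
    by_contra! hk
    exact hno x ⟨hx, ⟨y, hy, hs.2.1.symm⟩, hk, col⟩
  exact ⟨hx, hy, fun k hk _ => adj k hk, fun k hk _ => col k hk (adj k hk)⟩

include he

/-- If the near side of a partial apex is not a clique, it consists of two vertices. -/
theorem PartialApex.near_eq {t y z k : V} (ht : PartialApex G c q e t) (hy : Span G e y)
    (hz : Span G e z) (hk : Span G e k) (hty : G.Adj t y) (htz : G.Adj t z) (htk : G.Adj t k)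
    (hyz : Gᶜ.Adj y z) (hcol : c q k = c q z) : k = z := by
  by_contra hne
  have hkz : G.Adj k z := by
    by_contra h
    have := hC.col_compl hc hk hz (compl_of hne h)
    simp [hcol] at this
  obtain ⟨l, hl⟩ := id hy
  have htl : ¬ G.Adj t l := (ht.sides.cross hl).1 hty
  have hkl : Gᶜ.Adj k l := ht.compl_of_col_ne hc hC he hk hl.span_snd htk htl (by
    rw [hcol, hC.col_compl hc hy hz hyz, ← hC.col_eq hc hl]; simp)
  have hs : Switch G (y, l) (k, z) := ⟨(hC.linked hc hl).adj, hkz, hyz, hkl.symm⟩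
  have := ht.sides.cross (hl.trans hs.linked)
  tauto

theorem PartialApex.eq_or_eq {t y z k : V} (ht : PartialApex G c q e t) (hy : Span G e y)
    (hz : Span G e z) (hk : Span G e k) (hyz' : G.Adj t y ↔ G.Adj t z)
    (hky : G.Adj t k ↔ G.Adj t z) (hyz : Gᶜ.Adj y z) : k = y ∨ k = z := by
  have hcol := hC.col_compl hc hy hz hyz
  by_cases htz : G.Adj t z
  · by_cases h : c q k = c q z
    · exact Or.inr (ht.near_eq hc hC he hy hz hk (hyz'.2 htz) htz (hky.2 htz) hyz h)
    · refine Or.inl (ht.near_eq hc hC he hz hy hk htz (hyz'.2 htz) (hky.2 htz) hyz.symm ?_)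
      rw [Bool.eq_not_of_ne h, hcol]; simp
  · by_cases h : c q k = c q z
    · exact Or.inr (ht.eq_of_col_eq hc hC he hk hz (mt hky.1 htz) htz h)
    · refine Or.inl (ht.eq_of_col_eq hc hC he hk hy (mt hky.1 htz) (mt hyz'.1 htz) ?_)
      rw [Bool.eq_not_of_ne h, hcol]; simp

/-- With respect to the sides given by a partial apex, the good edges form a union of components. -/
theorem GoodEdge.switch {t w z y x : V} (ht : PartialApex G c q e t)
    (h : GoodEdge G c q e (G.Adj t) w z) (hs : Switch G (w, z) (y, x)) :
    GoodEdge G c q e (G.Adj t) x y := by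
  have hS := ht.sides
  have hy := h.span_of_switch hc hC he hS.link hs
  have hz := h.span
  have hwx : Gᶜ.Adj w x := hs.2.2.1
  have hzy : Gᶜ.Adj z y := hs.2.2.2
  have hxy : G.Adj x y := hs.2.1.symm
  have cwz := h.col z hz Iff.rfl
  have cxy : c x y = c q y := by
    rw [hc.eq_not hxy hs.1 hwx.symm hzy.symm, hC.col_compl hc hz hy hzy]
    dsimp only
    rw [cwz]
  have hx : ¬ Span G e x := by
    intro hx
    have hnx : ¬ (G.Adj t x ↔ G.Adj t z) := fun hxz => not_adj_of hwx (h.adj x hx hxz)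
    by_cases htz : G.Adj t z
    · have htx : ¬ G.Adj t x := by tauto
      by_cases hty : G.Adj t y
      · by_cases hcol : c q y = c q x
        · have := hC.col_linked hc (ht.linked_of_col_eq hc hC he hy hx hty htx hcol)
          rw [hc.symm y x, cxy] at this
          simp at this
        · exact not_adj_of (ht.compl_of_col_ne hc hC he hy hx hty htx hcol) hxy.symm
      · exact ht.not_adj hc hC he hx hy htx hty hxy
    · have htx : G.Adj t x := by tauto
      exact not_adj_of hwx (ht.adj_near hc hC he h.not_span hx hz htx htz hs.1)
  have hadj : ∀ k, Span G e k → (G.Adj t k ↔ G.Adj t y) → G.Adj x k := fun k hk hky =>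
    (hS.adj_iff hx hk hy hky).2 hxy
  refine ⟨hx, hy, hadj, fun k hk hky => ?_⟩
  by_cases hyz : G.Adj t y ↔ G.Adj t z
  · rcases ht.eq_or_eq hc hC he hy hz hk hyz (hky.trans hyz) hzy.symm with rfl | rfl
    · exact cxy
    · exact hC.col_of_compl hc hk hy hzy hwx (hadj k hk hky) (h.adj y hy hyz) (h.col y hy hyz)
  · obtain ⟨_, y', k', h1, hs', h2⟩ := he.partner hk
    have hk' : G.Adj t k' ↔ G.Adj t z := by
      have := hS.cross h2
      have := hS.link h1 hs'
      tauto
    exact hC.col_of_compl hc hk h2.span_snd hs'.2.2.1 hwx (hadj k hk hky)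
      (h.adj k' h2.span_snd hk') (h.col k' h2.span_snd hk')

end

/-- The order is a lexicographic breadth-first search order: if the first vertex that distinguishes
`a` and `b` precedes both of them, then the one adjacent to it comes first. -/
def IsLexBFS [LinearOrder V] (G : SimpleGraph V) : Prop :=
  ∀ ⦃a b t : V⦄, t < a → t < b → G.Adj t a → ¬ G.Adj t b →
    (∀ s < t, G.Adj s a ↔ G.Adj s b) → a < b

/-- Let `u` be the smallest vertex of the base. If the good edges form a union of components, the
smallest of them leads from some `w < u` to some `z > u`, and it has colour `false`. -/
theorem GoodEdge.exists_min [LinearOrder V] [Finite V] {q r u : V} {e : V × V} {S : V → Prop}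
    (hc : IsProper G c) (hC : Cone G c q r e.1 e.2) (hlex : LexMinFalse G c)
    (hclosed : ∀ w z y x, GoodEdge G c q e S w z → Switch G (w, z) (y, x) →
      GoodEdge G c q e S x y)
    (hu : Span G e u) (hmin : ∀ k, Span G e k → u ≤ k) (hcol : c q u = true) :
    ∃ w z, GoodEdge G c q e S w z ∧ c q z = false ∧ w < u ∧ u < z ∧
      ∀ k, GoodEdge G c q e S w k → z ≤ k := by
  let B : V × V → Prop := fun p => GoodEdge G c q e S p.1 p.2 ∨ GoodEdge G c q e S p.2 p.1
  have hB : ∀ p p', Linked G p p' → B p → B p' := by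
    intro p p' hpp hp
    refine hpp.induction hp (fun _ h => h.symm) ?_
    rintro ⟨a, b⟩ ⟨a', b'⟩ - hs (h | h)
    · exact Or.inr (hclosed _ _ _ _ h hs)
    · exact Or.inl (hclosed _ _ _ _ h hs.swap)
  obtain ⟨p, hp, hpmin⟩ := Set.exists_min_image {p | B p} toLex (Set.toFinite _)
    ⟨(u, q), Or.inr (hC.goodEdge hc hu)⟩
  have hadj : G.Adj p.1 p.2 := by
    rcases hp with h | h
    · exact h.adj _ h.span Iff.rfl
    · exact (h.adj _ h.span Iff.rfl).symm
  have hcp : c p.1 p.2 = false := by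
    obtain ⟨m, hm, hcm, hle⟩ := hlex p hadj
    have : toLex m = toLex p := le_antisymm (hle _ (linked_refl _)) (hpmin _ (hB _ _ hm hp))
    rw [← toLex.injective this]
    exact hcm
  have hpu := hpmin (u, q) (Or.inr (hC.goodEdge hc hu))
  rw [Prod.Lex.toLex_le_toLex] at hpu
  have key : ∀ w z, GoodEdge G c q e S w z → c w z = false → c q z = false ∧ u < z := by
    intro w z h hwz
    have hqz : c q z = false := by rw [← h.col z h.span Iff.rfl, hwz]
    refine ⟨hqz, lt_of_le_of_ne (hmin z h.span) ?_⟩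
    rintro rfl
    simp [hcol] at hqz
  obtain ⟨w, z⟩ := p
  dsimp only at hpu hcp
  rcases hp with h | h
  · obtain ⟨h1, h2⟩ := key w z h hcp
    refine ⟨w, z, h, h1, ?_, h2, fun k hk => ?_⟩
    · rcases hpu with h | ⟨rfl, -⟩
      · exact h
      · exact absurd hu h.not_span
    · have := hpmin (w, k) (Or.inl hk)
      rw [Prod.Lex.toLex_le_toLex] at this
      simpa using this
  · obtain ⟨h1, h2⟩ := key z w h (by rw [hc.symm]; exact hcp)
    rcases hpu with h | ⟨h, -⟩
    · exact absurd h (lt_asymm h2)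
    · exact absurd h h2.ne'

/-- The lexicographic colouring with respect to a lexicographic breadth-first search order has no
cone over an edge that is not isolated in `G*`. -/
theorem coneFree_of_lex [LinearOrder V] [Finite V] (hc : IsProper G c) (hlex : LexMinFalse G c)
    (hG : IsLexBFS G) : ConeFree G c := by
  intro q r s t hC he
  obtain ⟨⟨u, v⟩, hm, hcm, hle⟩ := hlex (s, t) hC.adj
  set e : V × V := (s, t) with hedef
  replace hC : Cone G c q r e.1 e.2 := hC
  have hu : Span G e u := hm.span_fst
  have hv : Span G e v := hm.span_snd
  have hmin : ∀ k, Span G e k → u ≤ k := by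
    rintro k ⟨l, hl⟩
    have := hle _ hl
    rw [Prod.Lex.toLex_le_toLex] at this
    rcases this with h | ⟨h, -⟩
    · exact h.le
    · exact h.le
  have hout : ∀ k < u, ¬ Span G e k := fun k hk h => not_lt.2 (hmin k h) hk
  have huv : G.Adj u v := (hC.linked hc hm).adj
  have hcu : c q u = true := by
    rw [(hC.linked hc hm).cqs]
    simpa using hcm
  by_cases hno : ∀ t, ¬ PartialApex G c q e t
  · obtain ⟨w, z, h, hcz, hwu, huz, hmz⟩ := GoodEdge.exists_min hc hC hlex
      (fun w z y x h hs => h.switch_of_forall hc hC he hno hs) hu hmin hcu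
    exact not_lt.2 (hmz u ⟨h.not_span, hu, fun k hk _ => h.adj k hk Iff.rfl,
      fun k hk _ => h.col k hk Iff.rfl⟩) huz
  · push Not at hno
    obtain ⟨t, ht⟩ := hno
    obtain ⟨w, z, h, hcz, hwu, huz, hmz⟩ := GoodEdge.exists_min hc hC hlex
      (fun w z y x h hs => h.switch hc hC he ht hs) hu hmin hcu
    have hS := ht.sides
    have hz := h.span
    have hside : ¬ (G.Adj t u ↔ G.Adj t z) := fun hside =>
      not_lt.2 (hmz u ⟨h.not_span, hu, fun k hk hku => h.adj k hk (hku.trans hside),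
        fun k hk hku => h.col k hk (hku.trans hside)⟩) huz
    have hvside : G.Adj t v ↔ G.Adj t z := by
      have := hS.cross hm
      tauto
    by_cases hwu' : G.Adj w u
    · -- `z` and `v` are on the same side, and `u` is the first vertex that distinguishes them.
      have hcv : c q v = true := by rw [← hC.col_eq hc hm, hcu]
      have hne : z ≠ v := by rintro rfl; simp [hcz] at hcv
      have hzv : z < v := lt_of_le_of_ne (hmz v ⟨h.not_span, hv,
        fun k hk hkv => h.adj k hk (hkv.trans hvside),
        fun k hk hkv => h.col k hk (hkv.trans hvside)⟩) hne
      have huz' : Gᶜ.Adj u z := by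
        by_cases htu : G.Adj t u
        · exact ht.compl_of_col_ne hc hC he hu hz htu (by tauto) (by simp [hcu, hcz])
        · exact (ht.compl_of_col_ne hc hC he hz hu (by tauto) htu (by simp [hcu, hcz])).symm
      exact lt_asymm hzv (hG (huz.trans hzv) huz huv (not_adj_of huz')
        fun s hs => hS.adj_iff (hout s hs) hv hz hvside)
    · have hwz : G.Adj w z := h.adj z hz Iff.rfl
      have htz : G.Adj t z := by
        by_contra htz
        exact hwu' (ht.adj_near hc hC he h.not_span hu hz (by tauto) htz hwz)
      -- The first vertex `s ≤ w` that distinguishes `u` and `z` is adjacent to the far side only.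
      obtain ⟨s, hs, hsmin⟩ := (Finite.to_wellFoundedLT (α := V)).wf.has_min
        {s | ¬ (G.Adj s u ↔ G.Adj s z)} ⟨w, by simp [hwu', hwz]⟩
      have hsw : s ≤ w := not_lt.1 (hsmin w (by simp [hwu', hwz]))
      have hsu : s < u := hsw.trans_lt hwu
      replace hsmin : ∀ s' < s, G.Adj s' u ↔ G.Adj s' z := fun s' hs' => by
        by_contra h
        exact hsmin s' h hs'
      have hsadj : G.Adj s u ∧ ¬ G.Adj s z := by
        by_contra hcon
        have hs1 : G.Adj s z ∧ ¬ G.Adj s u := by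
          have hs : ¬ (G.Adj s u ↔ G.Adj s z) := hs
          tauto
        exact lt_asymm huz (hG (hsu.trans huz) hsu hs1.1 hs1.2 fun s' hs' => (hsmin s' hs').symm)
      exact hsadj.2 (ht.adj_near hc hC he (hout s hsu) hz hu htz (by tauto) hsadj.1)

/-! ### Existence of the order and of the colouring -/

/-- Every finite graph has a lexicographic breadth-first search order: take an enumeration that
maximises the upper triangle of the adjacency matrix, read column by column. If it violated the
condition at `b < a`, exchanging `a` and `b` would increase that word. -/
theorem exists_isLexBFS [Finite V] (G : SimpleGraph V) :
    ∃ lo : LinearOrder V, @IsLexBFS V lo G := by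
  classical
  obtain ⟨n, ⟨σ₀⟩⟩ := Finite.exists_equiv_fin V
  let key : (Fin n ≃ V) → Lex (Lex (Fin n × Fin n) → Bool) := fun σ =>
    toLex fun p => decide ((ofLex p).2 < (ofLex p).1 ∧ G.Adj (σ (ofLex p).2) (σ (ofLex p).1))
  have hkey : ∀ σ k i, key σ (toLex (k, i)) = decide (i < k ∧ G.Adj (σ i) (σ k)) :=
    fun _ _ _ => rfl
  have : Nonempty (Fin n ≃ V) := ⟨σ₀.symm⟩
  obtain ⟨σ, hσ⟩ := Finite.exists_max key
  refine ⟨LinearOrder.lift' σ.symm σ.symm.injective, ?_⟩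
  intro a b t hta htb ha hb heq
  change σ.symm t < σ.symm a at hta
  change σ.symm t < σ.symm b at htb
  change ∀ s, σ.symm s < σ.symm t → _ at heq
  change σ.symm a < σ.symm b
  by_contra hab
  have hne : a ≠ b := by rintro rfl; exact hb ha
  have hlt : σ.symm b < σ.symm a :=
    lt_of_le_of_ne (not_lt.1 hab) fun h => hne (σ.symm.injective h.symm)
  obtain ⟨j, rfl⟩ := σ.surjective b
  obtain ⟨k, rfl⟩ := σ.surjective a
  obtain ⟨i, rfl⟩ := σ.surjective t
  simp only [Equiv.symm_apply_apply] at hta htb hlt heq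
  refine not_lt.2 (hσ ((Equiv.swap j k).trans σ)) ?_
  have hfix : ∀ m < j, Equiv.swap j k m = m := fun m hm =>
    Equiv.swap_apply_of_ne_of_ne hm.ne (hm.trans hlt).ne
  refine ⟨toLex (j, i), ?_, ?_⟩
  · rintro p hp
    obtain ⟨⟨k', i'⟩, rfl⟩ := toLex.surjective p
    rw [Prod.Lex.toLex_lt_toLex] at hp
    dsimp only at hp
    change key σ (toLex (k', i')) = key _ (toLex (k', i'))
    rw [hkey, hkey, decide_eq_decide, Equiv.trans_apply, Equiv.trans_apply]
    rcases hp with hp | ⟨rfl, hp⟩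
    · refine and_congr_right fun hi => ?_
      rw [hfix k' hp, hfix i' (hi.trans hp)]
    · rw [hfix i' (hp.trans htb), Equiv.swap_apply_left, heq (σ i') (by simpa using hp)]
  · change key σ (toLex (j, i)) < key _ (toLex (j, i))
    rw [hkey, hkey, Equiv.trans_apply, Equiv.trans_apply, hfix i htb, Equiv.swap_apply_left,
      decide_eq_false fun h => hb h.2, decide_eq_true ⟨htb, ha⟩]
    exact Bool.false_lt_true

/-- A proper colouring can be normalised on each component of `G*` separately. -/
theorem IsProper.exists_lexMinFalse [LinearOrder V] [Finite V] {c₀ : V → V → Bool}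
    (hc : IsProper G c₀) : ∃ c, IsProper G c ∧ LexMinFalse G c := by
  have hrep : ∀ p : V × V, ∃ m, Linked G p m ∧ ∀ q, Linked G p q → toLex m ≤ toLex q := fun p =>
    Set.exists_min_image {q | Linked G p q} toLex (Set.toFinite _) ⟨p, linked_refl p⟩
  choose rep hrep hmin using hrep
  have hrep_eq : ∀ {p q}, Linked G p q → rep p = rep q := fun {p q} h =>
    toLex.injective (le_antisymm (hmin _ _ (h.trans (hrep q))) (hmin _ _ (h.symm.trans (hrep p))))
  refine ⟨fun a b => (c₀ a b) ^^ (c₀ (rep (a, b)).1 (rep (a, b)).2), ⟨?_, ?_⟩, ?_⟩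
  · intro a b
    rw [hrep_eq (linked_swap (a, b)), hc.symm a b]
    rfl
  · intro a b x y hab hxy hax hby
    have hs : Switch G (a, b) (y, x) := ⟨hab, hxy.symm, hax, hby⟩
    rw [hrep_eq hs.linked.swap_right, hc.eq_not hab hxy hax hby]
    simp
  · intro p _
    refine ⟨rep p, hrep p, ?_, hmin p⟩
    have : rep (rep p) = rep p := (hrep_eq (hrep p)).symm
    simp [this]

/-- A 2-colouring of `G*` as a function on pairs of vertices. -/
theorem exists_isProper_of_colorable (h : (auxGraph G).Colorable 2) : ∃ c, IsProper G c := by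
  classical
  obtain ⟨col⟩ : Nonempty ((auxGraph G).Coloring Bool) := ⟨h.toColoring (by simp)⟩
  refine ⟨fun a b => if h : G.Adj a b then col ⟨s(a, b), h⟩ else false, ?_, ?_⟩
  · intro a b
    by_cases h : G.Adj a b
    · simp only [h, h.symm, dif_pos, Sym2.eq_swap]
    · have h' : ¬ G.Adj b a := fun h' => h h'.symm
      simp only [h, h', dif_neg, not_false_eq_true]
  · intro a b x y hab hxy hax hby
    simp only [hab, hxy, dif_pos]
    exact col.valid (show FormAlternating4Cycle G _ _ from
      ⟨a, b, y, x, rfl, Sym2.eq_swap, hab, hxy.symm, hax, hby⟩)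

/-! ### Edges that are isolated in the auxiliary graph -/

/-- The edge `st` is the bottom of a paraglider in which the two edges at the top vertex `p` have
colour `i`: if `st` had colour `i` as well, then `p q r p s t p` would be an alternating closed walk
of colour `i`. -/
def Paraglider (G : SimpleGraph V) (c : V → V → Bool) (i : Bool) (s t : V) : Prop :=
  ∃ p q r, Gᶜ.Adj q r ∧ Gᶜ.Adj p s ∧ Gᶜ.Adj p t ∧ G.Adj p q ∧ G.Adj p r ∧
    G.Adj q s ∧ G.Adj q t ∧ G.Adj r s ∧ G.Adj r t ∧ c p q = i ∧ c p r = i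

theorem Paraglider.symm {i : Bool} {s t : V} (h : Paraglider G c i s t) :
    Paraglider G c i t s := by
  obtain ⟨p, q, r, h1, h2, h3, h4, h5, h6, h7, h8, h9, h⟩ := h
  exact ⟨p, q, r, h1, h3, h2, h4, h5, h7, h6, h9, h8, h⟩

/-- Without alternating paths, no edge is the bottom of paragliders of both colours. -/
theorem not_paraglider_both (hc : IsProper G c) (hP : ∀ a z w b, ¬ AltPath G c a z w b) {s t : V}
    (h : Paraglider G c false s t) : ¬ Paraglider G c true s t := by
  obtain ⟨p, q, r, hqr, hps, -, hpq, hpr, hqs, -, hrs, -, cpq, cpr⟩ := h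
  rintro ⟨p', q', r', hqr', hps', -, hpq', hpr', hqs', -, hrs', -, cpq', cpr'⟩
  have cqs : c q s = true := by rw [hc.eq_not hqs hpr.symm hqr hps.symm, hc.symm r p, cpr]; rfl
  have crs : c r s = true := by
    rw [hc.eq_not hrs hpq.symm hqr.symm hps.symm, hc.symm q p, cpq]; rfl
  have cqs' : c q' s = false := by
    rw [hc.eq_not hqs' hpr'.symm hqr' hps'.symm, hc.symm r' p', cpr']; rfl
  have crs' : c r' s = false := by
    rw [hc.eq_not hrs' hpq'.symm hqr'.symm hps'.symm, hc.symm q' p', cpq']; rfl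
  have hqq : G.Adj q q' := hc.adj_of_eq hpq hqs'.symm hps (by rw [cpq, hc.symm s, cqs'])
    (by rintro rfl; simp [cqs] at cqs')
  have hrr : G.Adj r r' := hc.adj_of_eq hpr hrs'.symm hps (by rw [cpr, hc.symm s, crs'])
    (by rintro rfl; simp [crs] at crs')
  have nqq : NonIsolated G (q, q') := ⟨(r', r), hqq, hrr.symm, hqr, hqr'⟩
  cases hcol : c q q'
  · refine hP s q q' p' ⟨hps'.symm, ?_, ?_, ⟨(r, p), hqs.symm, hpr.symm, hps.symm, hqr⟩, nqq,
      ⟨(s, r'), hpq'.symm, hrs'.symm, hqr', hps'⟩⟩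
    · rw [hc.symm, cqs, hcol]; rfl
    · rw [hc.symm, cpq', hcol]; rfl
  · refine hP p q q' s ⟨hps, ?_, ?_, ⟨(r, s), hpq, hrs, hps, hqr⟩, nqq,
      ⟨(p', r'), hqs', hpr', hqr', hps'.symm⟩⟩
    · rw [cpq, hcol]; rfl
    · rw [cqs', hcol]; rfl

/-- Recolouring the edges that are isolated in `G*` so as to avoid paragliders of a single colour.
No colour class of the resulting colouring contains an alternating closed walk of length 6. -/
theorem exists_hexagonFree (hc : IsProper G c) (hD : ConeFree G c)
    (hP : ∀ a z w b, ¬ AltPath G c a z w b) :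
    ∃ c', IsProper G c' ∧ ∀ v₀ v₁ v₂ v₃ v₄ v₅, G.Adj v₀ v₁ → Gᶜ.Adj v₁ v₂ → G.Adj v₂ v₃ →
      Gᶜ.Adj v₃ v₄ → G.Adj v₄ v₅ → Gᶜ.Adj v₅ v₀ → c' v₀ v₁ = c' v₂ v₃ → c' v₂ v₃ ≠ c' v₄ v₅ := by
  classical
  obtain ⟨c', hc'⟩ : ∃ c' : V → V → Bool, ∀ s t, c' s t =
    if NonIsolated G (s, t) then c s t else decide (Paraglider G c false s t) := ⟨_, fun _ _ => rfl⟩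
  have hagree : ∀ {s t}, NonIsolated G (s, t) → c' s t = c s t := fun h => by rw [hc', if_pos h]
  have hproper : IsProper G c' := by
    refine ⟨fun a b => ?_, fun {a b x y} hab hxy hax hby => ?_⟩
    · by_cases h : NonIsolated G (a, b)
      · rw [hagree h, hagree h.swap, hc.symm]
      · have h' : ¬ NonIsolated G (b, a) := fun h' => h h'.swap
        rw [hc', hc', if_neg h, if_neg h', decide_eq_decide]
        exact ⟨Paraglider.symm, Paraglider.symm⟩
    · have hs : Switch G (a, b) (y, x) := ⟨hab, hxy.symm, hax, hby⟩
      rw [hagree ⟨_, hs⟩, hagree (NonIsolated.swap ⟨_, hs.symm⟩)]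
      exact hc.ne hab hxy hax hby
  have para : ∀ p q r s t, Gᶜ.Adj q r → Gᶜ.Adj p s → Gᶜ.Adj p t → G.Adj p q → G.Adj p r →
      G.Adj s t → c' p q = c' p r → c' p r ≠ c' s t := by
    intro p q r s t hqr hps hpt hpq hpr hst e1 e2
    have join : ∀ q s t, Gᶜ.Adj p s → Gᶜ.Adj p t → G.Adj p q → G.Adj s t → c' p q = c' s t →
        G.Adj q s := by
      intro q s t hps hpt hpq hst e
      exact hproper.adj_of_eq hpq hst.symm hpt (by rw [e, hproper.symm])
        (by rintro rfl; exact not_adj_of hps hpq)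
    have e2' := hproper.symm s t
    have hqs := join q s t hps hpt hpq hst (e1.trans e2)
    have hqt := join q t s hpt hps hpq hst.symm (by rw [e1, e2, e2'])
    have hrs := join r s t hps hpt hpr hst e2
    have hrt := join r t s hpt hps hpr hst.symm (by rw [e2, e2'])
    have npq : NonIsolated G (p, q) := ⟨(r, s), hpq, hrs, hps, hqr⟩
    have npr : NonIsolated G (p, r) := ⟨(q, s), hpr, hqs, hps, hqr.symm⟩
    rw [hagree npq, hagree npr] at e1
    rw [hagree npr] at e2
    have cone : ∀ q r s, Gᶜ.Adj q r → Gᶜ.Adj p s → G.Adj p r → G.Adj q s → c q s = !c p r := by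
      intro q r s hqr hps hpr hqs
      rw [hc.eq_not hqs hpr.symm hqr hps.symm, hc.symm]
    by_cases hn : NonIsolated G (s, t)
    · rw [hagree hn] at e2
      refine hD q r s t ⟨hqr, hst, hqs, hqt, hrs, hrt, ?_, ?_, ?_, ?_⟩ hn
      · rw [cone q r s hqr hps hpr hqs, e2]
      · rw [cone q r t hqr hpt hpr hqt, e2]
      · rw [cone r q s hqr.symm hps hpq hrs, e1, e2]
      · rw [cone r q t hqr.symm hpt hpq hrt, e1, e2]
    · have hpara : Paraglider G c (c p r) s t :=
        ⟨p, q, r, hqr, hps, hpt, hpq, hpr, hqs, hqt, hrs, hrt, e1, rfl⟩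
      rw [hc', if_neg hn] at e2
      cases hcol : c p r
      · rw [hcol] at e2 hpara
        simp [hpara] at e2
      · rw [hcol] at e2 hpara
        exact not_paraglider_both hc hP (of_decide_eq_true e2.symm) hpara
  refine ⟨c', hproper, fun v₀ v₁ v₂ v₃ v₄ v₅ h01 h12 h23 h34 h45 h50 e1 e2 => ?_⟩
  have e3 := hproper.symm
  by_cases h03 : v₀ = v₃
  · subst h03
    exact para v₀ v₁ v₂ v₄ v₅ h12 h34 h50.symm h01 h23.symm h45 (by rw [e1, e3]) (by rw [e3, e2])
  by_cases h25 : v₂ = v₅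
  · subst h25
    exact para v₂ v₃ v₄ v₀ v₁ h34 h50 h12.symm h23 h45.symm h01 (by rw [e2, e3])
      (by rw [e3, ← e2, e1])
  by_cases h41 : v₄ = v₁
  · subst h41
    exact para v₄ v₅ v₀ v₂ v₃ h50 h12 h34.symm h45 h01.symm h23 (by rw [e3 v₄ v₀, e1, e2])
      (by rw [e3, e1])
  -- The long diagonals of a proper hexagon are edges of the other colour.
  have diag : ∀ v₀ v₁ v₂ v₃ v₄ v₅, G.Adj v₀ v₁ → Gᶜ.Adj v₁ v₂ → G.Adj v₂ v₃ →
      Gᶜ.Adj v₃ v₄ → G.Adj v₄ v₅ → Gᶜ.Adj v₅ v₀ → c' v₀ v₁ = c' v₂ v₃ → c' v₂ v₃ = c' v₄ v₅ →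
      v₀ ≠ v₃ → Switch G (v₀, v₃) (v₄, v₅) := by
    intro v₀ v₁ v₂ v₃ v₄ v₅ h01 h12 h23 h34 h45 h50 e1 e2 hne
    exact ⟨hproper.adj_of_eq h01.symm h23 h12 (by rw [e3, e1]) hne, h45, h50.symm, h34⟩
  have s03 := diag v₀ v₁ v₂ v₃ v₄ v₅ h01 h12 h23 h34 h45 h50 e1 e2 h03
  have s25 := diag v₂ v₃ v₄ v₅ v₀ v₁ h23 h34 h45 h50 h01 h12 e2 (by rw [e1, e2]) h25
  have s41 := diag v₄ v₅ v₀ v₁ v₂ v₃ h45 h50 h01 h12 h23 h34 (by rw [e1, e2]) e1 h41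
  have n45 : NonIsolated G (v₄, v₅) := ⟨_, s03.symm⟩
  have n41 : NonIsolated G (v₄, v₁) := ⟨_, s41⟩
  have n25 : NonIsolated G (v₂, v₅) := ⟨_, s25⟩
  have d1 := hc.switch s25
  have d2 := hc.switch s41
  rw [← hagree ⟨_, s25⟩, ← hagree ⟨_, s25.symm⟩] at d1
  rw [← hagree ⟨_, s41⟩, ← hagree ⟨_, s41.symm⟩] at d2
  refine hP v₁ v₄ v₅ v₂ ⟨h12, ?_, ?_, n41.swap, n45, n25.swap⟩
  · rw [hc.symm, ← hagree n41, ← hagree n45, d2, e2]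
  · rw [hc.symm, ← hagree n25, ← hagree n45, d1, e1, e2]

/-! ### Alternating closed walks and threshold subgraphs -/

/-- `AltWalk F N k x y`: there is a walk from `x` to `y` along `k + 1` steps of `F`, with a step of
`N` between any two consecutive ones. -/
def AltWalk (F N : V → V → Prop) : ℕ → V → V → Prop
  | 0 => F
  | k + 1 => fun x y => ∃ a b, F x a ∧ N a b ∧ AltWalk F N k b y

section AltWalk

variable {F E N : V → V → Prop}

theorem AltWalk.append {k : ℕ} {x y a b : V} (h : AltWalk F N k x y) (hN : N y a) (hF : F a b) :
    AltWalk F N (k + 1) x b := by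
  induction k generalizing x with
  | zero => exact ⟨y, a, h, hN, hF⟩
  | succ k ih =>
    obtain ⟨u, v, h1, h2, h3⟩ := h
    exact ⟨u, v, h1, h2, ih h3⟩

/-- Let `F` and `N` be disjoint relations without alternating closed walks of lengths 4 and 6, and
let `E` contain the pairs that are in neither of them. If `E` and `N` have no alternating 4-cycle,
then there is no alternating closed walk at all. In a shortest one, of length at least 8, the pairs
`v₀v₃`, `v₂v₅`, `v₄v₋₁` and `v₆v₁` would be in `E` or trivial, which is impossible. -/
theorem AltWalk.not_closed (hFs : ∀ a b, F a b → F b a) (hNs : ∀ a b, N a b → N b a)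
    (htri : ∀ a b, a ≠ b → F a b ∨ E a b ∨ N a b) (hFN : ∀ a b, F a b → ¬ N a b)
    (hF : ∀ a b x y, F a b → N b x → F x y → ¬ N y a)
    (hE : ∀ a b x y, E a b → N b x → E x y → ¬ N y a)
    (h6 : ∀ a b x y z w, F a b → N b x → F x y → N y z → F z w → ¬ N w a)
    (k : ℕ) (x y : V) (h : AltWalk F N k x y) : ¬ N y x := by
  induction k using Nat.strong_induction_on generalizing x y with
  | _ k ih =>
  match k, ih, h with
  | 0, _, h => exact fun hN => hFN _ _ h (hNs _ _ hN)
  | 1, _, ⟨a, b, h1, h2, h3⟩ => exact hF _ _ _ _ h1 h2 h3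
  | 2, _, ⟨a, b, h1, h2, a', b', h3, h4, h5⟩ => exact h6 _ _ _ _ _ _ h1 h2 h3 h4 h5
  | k + 3, ih, ⟨v₁, v₂, h01, h12, v₃, v₄, h23, h34, v₅, v₆, h45, h56, hw⟩ =>
    intro hyx
    have t03 : x ≠ v₃ → E x v₃ := fun hne => by
      rcases htri _ _ hne with h | h | h
      · exact absurd hyx (ih (k + 2) (by omega) x y ⟨_, _, h, h34, _, _, h45, h56, hw⟩)
      · exact h
      · exact absurd (hNs _ _ h) (hF _ _ _ _ h01 h12 h23)
    have t25 : v₂ ≠ v₅ → E v₂ v₅ := fun hne => by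
      rcases htri _ _ hne with h | h | h
      · exact absurd hyx (ih (k + 2) (by omega) x y ⟨_, _, h01, h12, _, _, h, h56, hw⟩)
      · exact h
      · exact absurd (hNs _ _ h) (hF _ _ _ _ h23 h34 h45)
    have t61 : v₆ ≠ v₁ → E v₆ v₁ := fun hne => by
      rcases htri _ _ hne with h | h | h
      · exact absurd h56 (h6 _ _ _ _ _ _ h h12 h23 h34 h45)
      · exact h
      · exact absurd (hNs _ _ h) (ih (k + 1) (by omega) v₆ v₁ (hw.append hyx h01))
    have t4y : v₄ ≠ y → E v₄ y := fun hne => by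
      rcases htri _ _ hne with h | h | h
      · exact absurd h34 (h6 _ _ _ _ _ _ h hyx h01 h12 h23)
      · exact h
      · exact absurd (hNs _ _ h) (ih (k + 1) (by omega) v₄ y ⟨_, _, h45, h56, hw⟩)
    -- Two diagonals in `E` would form an alternating 4-cycle of `E` and `N`.
    have n1 : x = v₃ ∨ v₄ = y := by
      by_contra! hne
      exact hE _ _ _ _ (t03 hne.1) h34 (t4y hne.2) hyx
    have n2 : v₂ = v₅ ∨ v₆ = v₁ := by
      by_contra! hne
      exact hE _ _ _ _ (t25 hne.1) h56 (t61 hne.2) h12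
    rcases n1 with rfl | rfl <;> rcases n2 with rfl | rfl
    · exact hF _ _ _ _ h01 h12 (hFs _ _ h45) (hNs _ _ h34)
    · exact hF _ _ _ _ h45 h56 (hFs _ _ h01) h34
    · exact hF _ _ _ _ h01 h12 (hFs _ _ h45) hyx
    · exact hF _ _ _ _ h45 h56 (hFs _ _ h01) (hNs _ _ hyx)

/-- Without alternating closed walks, every finite non-empty set contains a vertex that is
isolated for `F` or for `N` in it; otherwise one could walk on forever. -/
theorem exists_isolated (hFN : ∀ k x y, AltWalk F N k x y → ¬ N y x) (S : Finset V)
    (hS : S.Nonempty) : ∃ v ∈ S, (∀ x ∈ S, ¬ F v x) ∨ (∀ x ∈ S, ¬ N v x) := by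
  by_contra! hcon
  choose! f hf using fun v hv => (hcon v hv).1
  choose! g hg using fun v hv => (hcon v hv).2
  obtain ⟨v, hv⟩ := hS
  let w : ℕ → V := fun n => (fun x => g (f x))^[n] v
  have hsucc : ∀ n, w (n + 1) = g (f (w n)) := fun n => Function.iterate_succ_apply' _ _ _
  have hw : ∀ n, w n ∈ S := by
    intro n
    induction n with
    | zero => exact hv
    | succ n ih => rw [hsucc]; exact (hg _ (hf _ ih).1).1
  have hF : ∀ n, F (w n) (f (w n)) := fun n => (hf _ (hw n)).2
  have hN : ∀ n, N (f (w n)) (w (n + 1)) := fun n => by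
    rw [hsucc]; exact (hg _ (hf _ (hw n)).1).2
  have hwalk : ∀ k n, AltWalk F N k (w n) (f (w (n + k))) := by
    intro k
    induction k with
    | zero => exact hF
    | succ k ih =>
      intro n
      refine ⟨_, _, hF n, hN n, ?_⟩
      have := ih (n + 1)
      rwa [Nat.add_right_comm] at this
  obtain ⟨i, j, hij, heq⟩ : ∃ i j, i < j ∧ w i = w j := by
    obtain ⟨i, j, hne, h⟩ := Finite.exists_ne_map_eq_of_infinite fun n => (⟨w n, hw n⟩ : S)
    have h : w i = w j := congrArg Subtype.val h
    rcases lt_or_gt_of_ne hne with hlt | hlt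
    · exact ⟨i, j, hlt, h⟩
    · exact ⟨j, i, hlt, h.symm⟩
  obtain ⟨k, rfl⟩ := Nat.exists_eq_add_of_lt hij
  exact hFN k _ _ (hwalk k i) (by rw [heq]; exact hN _)

end AltWalk

/-- A set `F` of edges of a finite graph `G` that has no alternating closed walk with the non-edges
of `G` extends to a threshold subgraph of `G`: remove a vertex that is isolated for `F` or for the
non-edges, extend the rest, and put the vertex back as an isolated or as a dominating one. -/
theorem exists_threshold_of_altWalk [Finite V] {F : V → V → Prop} (hFs : ∀ a b, F a b → F b a)
    (hFG : ∀ a b, F a b → G.Adj a b)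
    (hFN : ∀ k x y, AltWalk F (Gᶜ.Adj) k x y → ¬ Gᶜ.Adj y x) :
    ∃ H : SimpleGraph V, IsThreshold H ∧ H ≤ G ∧ ∀ a b, F a b → H.Adj a b := by
  classical
  have key : ∀ S : Finset V, ∃ H : SimpleGraph V, IsThreshold H ∧ H ≤ G ∧
      (∀ a b, H.Adj a b → a ∈ S) ∧ ∀ a ∈ S, ∀ b ∈ S, F a b → H.Adj a b := by
    intro S
    induction S using Finset.strongInduction with
    | _ S ih =>
    rcases S.eq_empty_or_nonempty with rfl | hS
    · exact ⟨⊥, fun e f ⟨a, b, c, d, _, _, h, _⟩ => h, bot_le, fun a b h => h.elim, by simp⟩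
    obtain ⟨v, hv, hiso⟩ := exists_isolated hFN S hS
    obtain ⟨H, hH, hHG, hHS, hHF⟩ := ih (S.erase v) (Finset.erase_ssubset hv)
    rcases hiso with hiso | hiso
    · refine ⟨H, hH, hHG, fun a b h => Finset.mem_of_mem_erase (hHS a b h), fun a ha b hb hab => ?_⟩
      refine hHF a (Finset.mem_erase.2 ⟨?_, ha⟩) b (Finset.mem_erase.2 ⟨?_, hb⟩) hab
      · rintro rfl; exact hiso b hb hab
      · rintro rfl; exact hiso a ha (hFs _ _ hab)
    · -- `v` dominates the rest of `S`.
      have hdom : ∀ x ∈ S, x ≠ v → G.Adj v x := fun x hx hne => by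
        by_contra h
        exact hiso x hx (compl_of hne.symm h)
      let H' : SimpleGraph V :=
        { Adj := fun a b => H.Adj a b ∨ (a = v ∧ b ∈ S ∧ b ≠ v) ∨ (b = v ∧ a ∈ S ∧ a ≠ v)
          symm := ⟨fun a b h => by rw [H.adj_comm]; tauto⟩
          loopless := ⟨fun a h => by
            rcases h with h | ⟨h, _, h'⟩ | ⟨h, _, h'⟩
            · exact H.loopless.irrefl a h
            · exact h' h
            · exact h' h⟩ }
      have hmem : ∀ a b, H'.Adj a b → a ∈ S := by
        rintro a b (h | ⟨rfl, _⟩ | ⟨_, h, _⟩)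
        · exact Finset.mem_of_mem_erase (hHS a b h)
        · exact hv
        · exact h
      have hvS : ∀ x ∈ S, ¬ H'ᶜ.Adj v x := fun x hx h =>
        not_adj_of h (Or.inr (Or.inl ⟨rfl, hx, (SimpleGraph.Adj.ne h).symm⟩))
      have hne : ∀ x ∈ S, ∀ y, H'ᶜ.Adj x y → y ≠ v := by
        rintro x hx y h rfl
        exact hvS x hx h.symm
      have hH' : ∀ a b, a ≠ v → b ≠ v → H'.Adj a b → H.Adj a b := by
        rintro a b ha hb (h | ⟨h, _⟩ | ⟨h, _⟩)
        · exact h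
        · exact absurd h ha
        · exact absurd h hb
      have hcompl : ∀ a b, H'ᶜ.Adj a b → Hᶜ.Adj a b := fun a b h =>
        compl_of (SimpleGraph.Adj.ne h) fun h' => not_adj_of h (Or.inl h')
      refine ⟨H', ?_, ?_, hmem, ?_⟩
      · rintro e f ⟨a, b, c, d, rfl, rfl, hab, hcd, had, hbc⟩
        have ha := hne _ (hmem _ _ hcd.symm) _ had.symm
        have hb := hne _ (hmem _ _ hcd) _ hbc.symm
        have hc := hne _ (hmem _ _ hab.symm) _ hbc
        have hd := hne _ (hmem _ _ hab) _ had
        exact hH _ _ ⟨a, b, c, d, rfl, rfl, hH' _ _ ha hb hab, hH' _ _ hc hd hcd,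
          hcompl _ _ had, hcompl _ _ hbc⟩
      · rintro a b (h | ⟨rfl, h, h'⟩ | ⟨rfl, h, h'⟩)
        · exact hHG h
        · exact hdom b h h'
        · exact (hdom a h h').symm
      · intro a ha b hb hab
        have hab' := (hFG a b hab).ne
        by_cases hav : a = v
        · exact Or.inr (Or.inl ⟨hav, hb, fun h => hab' (hav.trans h.symm)⟩)
        by_cases hbv : b = v
        · exact Or.inr (Or.inr ⟨hbv, ha, hav⟩)
        exact Or.inl (hHF a (Finset.mem_erase.2 ⟨hav, ha⟩) b (Finset.mem_erase.2 ⟨hbv, hb⟩) hab)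
  have := Fintype.ofFinite V
  obtain ⟨H, h1, h2, -, h3⟩ := key Finset.univ
  exact ⟨H, h1, h2, fun a b h => h3 a (Finset.mem_univ a) b (Finset.mem_univ b) h⟩

/-! ### Threshold covers and colourings of the auxiliary graph -/

theorem hasThresholdCover_two_of_colorable [Finite V] (h : (auxGraph G).Colorable 2) :
    HasThresholdCover G 2 := by
  obtain ⟨c₀, hc₀⟩ := exists_isProper_of_colorable h
  obtain ⟨lo, hlo⟩ := exists_isLexBFS G
  obtain ⟨c₁, hc₁, hlex⟩ := hc₀.exists_lexMinFalse
  have hD := coneFree_of_lex hc₁ hlex hlo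
  obtain ⟨c, hc, h6⟩ := exists_hexagonFree hc₁ hD (not_altPath hc₁ hD hlex)
  have key : ∀ i : Bool, ∃ H : SimpleGraph V, IsThreshold H ∧ H ≤ G ∧
      ∀ a b, G.Adj a b ∧ c a b = i → H.Adj a b := by
    intro i
    have h4 : ∀ j a b x y, (G.Adj a b ∧ c a b = j) → Gᶜ.Adj b x → (G.Adj x y ∧ c x y = j) →
        ¬ Gᶜ.Adj y a := by
      rintro j a b x y ⟨hab, e1⟩ hbx ⟨hxy, e2⟩ hya
      exact hc.ne hab hxy.symm hya.symm hbx (by rw [hc.symm y x, e1, e2])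
    refine exists_threshold_of_altWalk (fun a b h => ⟨h.1.symm, by rw [hc.symm, h.2]⟩)
      (fun a b h => h.1) ?_
    refine AltWalk.not_closed (E := fun a b => G.Adj a b ∧ c a b = !i)
      (fun a b h => ⟨h.1.symm, by rw [hc.symm, h.2]⟩) (fun a b h => h.symm) ?_
      (fun a b h h' => not_adj_of h' h.1) (h4 i) (h4 (!i)) ?_
    · intro a b hne
      by_cases hab : G.Adj a b
      · by_cases hi : c a b = i
        · exact Or.inl ⟨hab, hi⟩
        · exact Or.inr (Or.inl ⟨hab, Bool.eq_not_of_ne hi⟩)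
      · exact Or.inr (Or.inr (compl_of hne hab))
    · rintro a b x y z w ⟨h1, e1⟩ h2 ⟨h3, e3⟩ h4 ⟨h5, e5⟩ h6'
      exact h6 a b x y z w h1 h2 h3 h4 h5 h6' (e1.trans e3.symm) (e3.trans e5.symm)
  choose H h1 h2 h3 using key
  refine ⟨![H false, H true], fun i => ?_, ?_⟩
  · fin_cases i
    · exact h1 false
    · exact h1 true
  · ext e
    simp only [Set.mem_iUnion, Fin.exists_fin_two, Matrix.cons_val_zero, Matrix.cons_val_one]
    induction e using Sym2.ind with
    | _ a b =>
    simp only [SimpleGraph.mem_edgeSet]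
    refine ⟨fun hab => ?_, ?_⟩
    · cases hcol : c a b
      · exact Or.inl (h3 false a b ⟨hab, hcol⟩)
      · exact Or.inr (h3 true a b ⟨hab, hcol⟩)
    · rintro (h | h)
      · exact h2 false h
      · exact h2 true h

theorem HasThresholdCover.colorable {k : ℕ} (h : HasThresholdCover G k) :
    (auxGraph G).Colorable k := by
  obtain ⟨H, hH, hG⟩ := h
  have hsub : ∀ i a b, (H i).Adj a b → G.Adj a b := fun i a b hab => by
    rw [← SimpleGraph.mem_edgeSet, hG]
    exact Set.mem_iUnion.2 ⟨i, hab⟩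
  have hmem : ∀ e : G.edgeSet, ∃ i, (e : Sym2 V) ∈ (H i).edgeSet := fun e =>
    Set.mem_iUnion.1 (hG.subset e.2)
  choose f hf using hmem
  refine ⟨SimpleGraph.Coloring.mk f fun {e e'} hadj heq => ?_⟩
  obtain ⟨a, b, x, y, he, he', hab, hxy, hay, hbx⟩ := hadj
  have h1 := hf e
  have h2 := hf e'
  rw [he, SimpleGraph.mem_edgeSet] at h1
  rw [he', ← heq, SimpleGraph.mem_edgeSet] at h2
  have hcompl : ∀ u v, Gᶜ.Adj u v → (H (f e))ᶜ.Adj u v := fun u v h =>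
    compl_of (SimpleGraph.Adj.ne h) fun h' => not_adj_of h (hsub _ _ _ h')
  exact hH (f e) _ _ ⟨a, b, x, y, he, he', h1, h2, hcompl _ _ hay, hcompl _ _ hbx⟩

theorem hasThresholdCover_one_of_colorable (h : (auxGraph G).Colorable 1) :
    HasThresholdCover G 1 := by
  obtain ⟨col⟩ := h
  refine ⟨fun _ => G, fun _ e f hef => ?_, (Set.iUnion_const _).symm⟩
  obtain ⟨a, b, x, y, rfl, rfl, hab, hxy, hay, hbx⟩ := id hef
  exact col.valid (v := ⟨s(a, b), hab⟩) (w := ⟨s(x, y), hxy⟩) hef (Subsingleton.elim _ _)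

theorem HasThresholdCover.mono {k l : ℕ} (h : HasThresholdCover G k) (hkl : k ≤ l) :
    HasThresholdCover G l := by
  obtain ⟨H, hH, hG⟩ := h
  refine ⟨fun i => if hi : i.1 < k then H ⟨i, hi⟩ else ⊥, fun i => ?_, ?_⟩
  · by_cases hi : i.1 < k
    · simp only [hi, dif_pos]
      exact hH _
    · simp only [hi, dif_neg, not_false_eq_true]
      rintro e f ⟨a, b, x, y, -, -, h, -⟩
      exact h
  · rw [hG]
    ext e
    simp only [Set.mem_iUnion]
    constructor
    · rintro ⟨i, hi⟩
      exact ⟨Fin.castLE hkl i, by simpa using hi⟩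
    · rintro ⟨i, hi⟩
      by_cases hk : i.1 < k
      · exact ⟨⟨i, hk⟩, by simpa [hk] using hi⟩
      · simp [hk] at hi

theorem thresholdDimension_le_iff {k : ℕ} :
    thresholdDimension G ≤ k ↔ HasThresholdCover G k := by
  refine ⟨fun h => ?_, fun h => iInf₂_le k h⟩
  by_contra hcon
  have : ((k + 1 : ℕ) : ℕ∞) ≤ thresholdDimension G := le_iInf₂ fun l hl => by
    have : k < l := by
      by_contra hlk
      exact hcon (HasThresholdCover.mono hl (not_lt.1 hlk))
    exact_mod_cast this
  have := this.trans h
  norm_cast at this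
  omega

theorem chromaticNumber_le_iff {k : ℕ}
    (h : (auxGraph G).Colorable k → HasThresholdCover G k) :
    (auxGraph G).chromaticNumber ≤ k ↔ thresholdDimension G ≤ k := by
  rw [SimpleGraph.chromaticNumber_le_iff_colorable, thresholdDimension_le_iff]
  exact ⟨h, HasThresholdCover.colorable⟩

end ThresholdCover

theorem theorem1 {V : Type*} [Finite V] (G : SimpleGraph V) :
    (ThresholdCover.auxGraph G).chromaticNumber = 2 ↔ ThresholdCover.thresholdDimension G = 2 := by
  have h1 := ThresholdCover.chromaticNumber_le_iff
    (ThresholdCover.hasThresholdCover_one_of_colorable (G := G))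
  have h2 := ThresholdCover.chromaticNumber_le_iff
    (ThresholdCover.hasThresholdCover_two_of_colorable (G := G))
  have key : ∀ n : ℕ∞, n = 2 ↔ n ≤ (2 : ℕ) ∧ ¬ n ≤ (1 : ℕ) := by
    intro n
    induction n using ENat.recTopCoe with
    | top => decide
    | coe n => norm_cast; omega
  rw [key, key, h1, h2]
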